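/- **Setting.** Let $X$ be a set (the instance space), $\mathcal H$ a finite or infinite set of hypotheses $h:X\to\{-1,1\}$, and $(x_1,y_1),\dots,(x_m,y_m)\in X\times\{-1,1\}$ a training sample. The row of $h$ is the 0-1 vector $\eta\in\{0,1\}^m$ with $\eta(i)=1$ iff $h(x_i)\ne y_i$. Let $M$ be the finite set of rows of hypotheses in $\mathcal H$ and $H(\eta)\subseteq\mathcal H$ the set of hypotheses with row $\eta$. Let $\Delta_m=\{w\in\mathbb R^m: w(i)\ge 0,\ \sum_i w(i)=1\}$ and $\sigma_0=\{w\in\Delta_m:\eta\cdot w>0\ \ \forall\eta\in M\}$. Fix a tie-breaking function $\mathrm{AdaSelect}$, choosing an element of each nonempty subset of $M$, and put $\eta^w=\mathrm{AdaSelect}(\arg\min_{\eta\in M}\eta\cdot w)$, $\sigma^*(\eta)=\{w\in\Delta_m:\eta=\eta^w\}$, $\sigma(\eta)=\{w\in\Delta_m:\eta\in\arg\min_{\eta'\in M}\eta'\cdot w\}$, $\epsilon(w)=\min_{\eta\in M}\eta\cdot w$ and $\alpha(w)=\tfrac12\log\frac{1-\epsilon(w)}{\epsilon(w)}$. The AdaBoost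 update $\mathcal A$, defined on $\sigma_0$ (where no error vanishes), is $$[\mathcal A(w)]_i=\tfrac12\,w(i)\Big(\frac1{\eta\cdot w}\Big)^{\eta(i)}\Big(\frac1{1-\eta\cdot w}\Big)^{1-\eta(i)},\qquad \eta=\eta^w .$$ Let $\Omega_\infty=\bigcap_{t\ge1}\mathcal A^{(t)}(\sigma_0)$. **Assumptions.** 1. (Weak learning) There is $\gamma>0$ such that $\epsilon(w)<\frac12-\gamma$ for all $w\in\Delta_m$. 2. (No ties eventually) There is a compact $G\subseteq\Delta_m$ with $\Omega_\infty\subseteq G$ such that for all $\eta,\eta'\in M$ either $\sigma(\eta)\cap\sigma(\eta')\cap G=\emptyset$, or $\sum_{i:\eta(i)\ne\eta'(i)}w(i)=0$ for all $w\in G$. Moreover $\Omega_\infty\neq\emptyset$. 3. (Framework) The weak learner uses one representative $h^\eta\in H(\eta)$ for each $\eta\in M$: for the weight $w$ it returns the hypothesis $h^{\eta^w}$. For an initial weight $w_1\in\sigma_0$ let $w_t=\mathcal A^{(t-1)}(w_1)$, $\alpha_t=\alpha(w_t)$, let $h_t=h^{\eta^{w_t}}$ be the hypothesis returned in round $t$,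 and put $F_T(x)=\sum_{t=1}^T\alpha_th_t(x)$, $\mathrm{margin}_T(x)=F_T(x)\big(\sum_{t=1}^T\alpha_t\big)^{-1}$ and $C_\eta(T)=\sum_{t=1}^T\alpha_t\mathbf 1[w_t\in\sigma^*(\eta)]$. **Statement.** There is a Borel probability measure on $\sigma_0\subseteq\Delta_m$ preserved by $\mathcal A$. For every such measure $\mu$ and for $\mu$-almost every initial weight $w_1$, the limits $\tilde C_\eta=\lim_{T\to\infty}C_\eta(T)\big(\sum_{t=1}^T\alpha_t\big)^{-1}$ exist for all $\eta\in M$ and form a probability distribution on $M$, and for **all** $x\in X$ the margin converges: $$\lim_{T\to\infty}\mathrm{margin}_T(x)=\sum_{\eta\in M}\tilde C_\eta\,h^\eta(x).$$ -/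

import Mathlib

open Filter Topology MeasureTheory

namespace AdaBoost

/-- A row of the error matrix: a 0-1 vector over the `m` training examples;
`η i = 1` means that example `i` is classified incorrectly. -/
abbrev Row (m : ℕ) : Type := Fin m → Fin 2

section Matrix

variable {X : Type*} {m : ℕ}

/-- The row of a hypothesis `h : X → {-1, 1}` on the sample `(x i, y i)`: the indicator of the
examples on which `h` is wrong. -/
def errorRow (x : Fin m → X) (y : Fin m → ℤˣ) (h : X → ℤˣ) : Row m :=
  fun i => if h (x i) = y i then 0 else 1

open Classical in
/-- The error matrix `M`, as the (finite) set of its rows. -/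
noncomputable def errorMatrix (H : Set (X → ℤˣ)) (x : Fin m → X) (y : Fin m → ℤˣ) :
    Finset (Row m) :=
  Finset.univ.filter fun η => ∃ h ∈ H, errorRow x y h = η

/-- The class `H(η)` of all hypotheses in `H` whose row is `η`. -/
def hypClass (H : Set (X → ℤˣ)) (x : Fin m → X) (y : Fin m → ℤˣ) (η : Row m) :
    Set (X → ℤˣ) :=
  {h | h ∈ H ∧ errorRow x y h = η}

end Matrix

section Dynamics

variable {m : ℕ}

/-- The weighted error `η · w`. -/
def err (η : Row m) (w : Fin m → ℝ) : ℝ := ∑ i, ((η i : ℕ) : ℝ) * w i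

open Classical in
/-- `argmin_{η ∈ M} η · w`. -/
noncomputable def argminRows (M : Finset (Row m)) (w : Fin m → ℝ) : Finset (Row m) :=
  M.filter fun η => ∀ η' ∈ M, err η w ≤ err η' w

/-- `sel` is a tie-breaking function (`AdaSelect`) for `M`: it picks a member of every nonempty
set of rows of `M`. -/
def IsTieBreaking (M : Finset (Row m)) (sel : Finset (Row m) → Row m) : Prop :=
  ∀ E ⊆ M, E.Nonempty → sel E ∈ E

/-- The selected best row `η^w`. -/
noncomputable def bestRow (M : Finset (Row m)) (sel : Finset (Row m) → Row m)
    (w : Fin m → ℝ) : Row m :=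
  sel (argminRows M w)

/-- `σ*(η)`: the weights for which `η` is the selected best row. -/
def sigmaStar (M : Finset (Row m)) (sel : Finset (Row m) → Row m) (η : Row m) :
    Set (Fin m → ℝ) :=
  {w | w ∈ stdSimplex ℝ (Fin m) ∧ η = bestRow M sel w}

/-- `σ(η)`: the weights for which `η` is one of the best rows. -/
def sigma (M : Finset (Row m)) (η : Row m) : Set (Fin m → ℝ) :=
  {w | w ∈ stdSimplex ℝ (Fin m) ∧ η ∈ argminRows M w}

/-- `σ₀`: the weights for which every row of `M` has positive error. -/
def sigmaZero (M : Finset (Row m)) : Set (Fin m → ℝ) :=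
  {w | w ∈ stdSimplex ℝ (Fin m) ∧ ∀ η ∈ M, 0 < err η w}

/-- The hypothetical update `𝒯_η`. -/
noncomputable def hypUpdate (η : Row m) (w : Fin m → ℝ) : Fin m → ℝ :=
  fun i => 1 / 2 * w i * (1 / err η w) ^ (η i : ℕ) * (1 / (1 - err η w)) ^ (1 - (η i : ℕ))

/-- The AdaBoost weight update `𝒜 w = 𝒯_{η^w} w`. Its formula is meaningful (no division by zero)
exactly when the minimal error is neither `0` nor `1`; under weak learnability this is the set
`σ₀`, which `𝒜` maps into itself. -/
noncomputable def update (M : Finset (Row m)) (sel : Finset (Row m) → Row m)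
    (w : Fin m → ℝ) : Fin m → ℝ :=
  hypUpdate (bestRow M sel w) w

/-- `ε(w) = min_{η ∈ M} η · w`. -/
noncomputable def eps (M : Finset (Row m)) (w : Fin m → ℝ) : ℝ :=
  sInf ((fun η => err η w) '' (M : Set (Row m)))

/-- `α(w) = ½ log ((1 - ε(w)) / ε(w))`. -/
noncomputable def alpha (M : Finset (Row m)) (w : Fin m → ℝ) : ℝ :=
  1 / 2 * Real.log ((1 - eps M w) / eps M w)

/-- Weak learnability: some `γ > 0` is such that for every distribution over the examples
some row has error less than `1/2 - γ`. -/
def WeakLearnable (M : Finset (Row m)) : Prop :=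
  ∃ γ : ℝ, 0 < γ ∧ ∀ w ∈ stdSimplex ℝ (Fin m), ∃ η ∈ M, err η w < 1 / 2 - γ

/-- `Ω_∞ = ⋂_{t ≥ 1} 𝒜^t(Δ_m)`, the images being those of the domain `σ₀` of `𝒜`. -/
def omegaInf (M : Finset (Row m)) (sel : Finset (Row m) → Row m) : Set (Fin m → ℝ) :=
  ⋂ t : ℕ, ⋂ _ : 1 ≤ t, (update M sel)^[t] '' sigmaZero M

/-- Optimal AdaBoost eventually has no ties. -/
def NoTies (M : Finset (Row m)) (sel : Finset (Row m) → Row m) : Prop :=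
  ∃ G : Set (Fin m → ℝ), G ⊆ stdSimplex ℝ (Fin m) ∧ IsCompact G ∧ omegaInf M sel ⊆ G ∧
    ∀ η ∈ M, ∀ η' ∈ M,
      sigma M η ∩ sigma M η' ∩ G = ∅ ∨
        ∀ w ∈ G, ∑ i ∈ Finset.univ.filter (fun i => η i ≠ η' i), w i = 0

/-- `μ` is a Borel probability measure on the domain `σ₀ ⊆ Δ_m` of `𝒜` that `𝒜` preserves. -/
structure IsInvariantProb (M : Finset (Row m)) (sel : Finset (Row m) → Row m)
    (μ : Measure (Fin m → ℝ)) : Prop where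
  prob : IsProbabilityMeasure μ
  support : ∀ᵐ w ∂μ, w ∈ sigmaZero M
  invariant : MeasurePreserving (update M sel) μ μ

/-- The weight `w_t = 𝒜^(t-1) w₁`, with rounds counted from `0`: `weight M sel w₁ s` is
`w_{s+1}`. -/
noncomputable def weight (M : Finset (Row m)) (sel : Finset (Row m) → Row m)
    (w₁ : Fin m → ℝ) (s : ℕ) : Fin m → ℝ :=
  (update M sel)^[s] w₁

/-- `∑_{t=1}^T α_t`. -/
noncomputable def alphaSum (M : Finset (Row m)) (sel : Finset (Row m) → Row m)
    (w₁ : Fin m → ℝ) (T : ℕ) : ℝ :=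
  ∑ s ∈ Finset.range T, alpha M (weight M sel w₁ s)

/-- `C_η(T) = ∑_{t=1}^T α(w_t) χ_{σ*(η)}(w_t)`. -/
noncomputable def coeffSum (M : Finset (Row m)) (sel : Finset (Row m) → Row m)
    (w₁ : Fin m → ℝ) (η : Row m) (T : ℕ) : ℝ :=
  ∑ s ∈ Finset.range T,
    alpha M (weight M sel w₁ s) *
      (sigmaStar M sel η).indicator (fun _ => (1 : ℝ)) (weight M sel w₁ s)

end Dynamics

section Classifier

variable {X : Type*} {m : ℕ}

/-- The weak learner `L`, which returns a hypothesis for each weight, follows the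
representative-hypothesis framework with representatives `rep η = h^η`: each `h^η` lies in the
class `H(η)`, and `L` returns `h^η` whenever `η = η^w`. -/
def FollowsFramework (H : Set (X → ℤˣ)) (x : Fin m → X) (y : Fin m → ℤˣ)
    (sel : Finset (Row m) → Row m) (L : (Fin m → ℝ) → X → ℤˣ) (rep : Row m → X → ℤˣ) : Prop :=
  (∀ η ∈ errorMatrix H x y, rep η ∈ hypClass H x y η) ∧
    ∀ w ∈ stdSimplex ℝ (Fin m), L w = rep (bestRow (errorMatrix H x y) sel w)

/-- `F_T(z) = ∑_{t=1}^T α_t h_t(z)`, where `h_t = L(w_t)` is the hypothesis of round `t`. -/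
noncomputable def classifierSum (M : Finset (Row m)) (sel : Finset (Row m) → Row m)
    (L : (Fin m → ℝ) → X → ℤˣ) (w₁ : Fin m → ℝ) (T : ℕ) (z : X) : ℝ :=
  ∑ s ∈ Finset.range T,
    alpha M (weight M sel w₁ s) * (((L (weight M sel w₁ s) z : ℤˣ) : ℤ) : ℝ)

/-- `margin_T(z) = F_T(z) (∑_{t=1}^T α_t)⁻¹`. -/
noncomputable def margin (M : Finset (Row m)) (sel : Finset (Row m) → Row m)
    (L : (Fin m → ℝ) → X → ℤˣ) (w₁ : Fin m → ℝ) (T : ℕ) (z : X) : ℝ :=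
  classifierSum M sel L w₁ T z * (alphaSum M sel w₁ T)⁻¹

end Classifier

end AdaBoost

/-! Existence of `μ`. One round at most halves any weight, hence any error, while the row just used
gets error exactly 1/2. A pigeonhole argument over `m + 1` rounds turns this into a lower bound for
all errors that is uniform over `σ₀` (`errorBound_le_err_iterate_update`). So the closure of `Ω_∞`
is compact and stays away from the singularities of the update. There two best rows differ only on
examples of weight zero and give the same update, so the update is continuous
(`continuousOn_update`), and Krylov–Bogoliubov yields an invariant measure.

Convergence. By invariance every such `μ` is carried by the set where the errors obey the bound, so
`α` is bounded along almost every orbit. Birkhoff's theorem, applied to `α` times the indicator of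
`σ*(η)` for each of the finitely many rows, makes all `C_η(T) / T` converge almost surely. Their sum
over `M` is `(∑ α_t) / T`, whose limit is positive by weak learning, so the quotients converge. The
margin at any point is a combination of these quotients with the fixed coefficients `h^η(x)`, so one
null set serves every `x`. -/

section Birkhoff

/-! ### Birkhoff's pointwise ergodic theorem for bounded functions. -/

variable {Ω : Type*} {T : Ω → Ω} {f : Ω → ℝ}

theorem abs_birkhoffAverage_le {B : ℝ} (hB : ∀ x, |f x| ≤ B) (n : ℕ) (x : Ω) :
    |birkhoffAverage ℝ T f n x| ≤ B := by
  have hB0 : 0 ≤ B := (abs_nonneg _).trans (hB x)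
  rw [birkhoffAverage, birkhoffSum, smul_eq_mul, abs_mul, abs_inv, Nat.abs_cast]
  rcases n.eq_zero_or_pos with rfl | hn
  · simpa using hB0
  have h : |∑ k ∈ Finset.range n, f (T^[k] x)| ≤ n * B :=
    (Finset.abs_sum_le_sum_abs _ _).trans <|
      (Finset.sum_le_sum fun k _ => hB (T^[k] x)).trans (by simp)
  have hn' : (0 : ℝ) < n := by exact_mod_cast hn
  rw [inv_mul_le_iff₀ hn']
  exact h

theorem isBoundedUnder_le_of_abs_le {u : ℕ → ℝ} {B : ℝ} (h : ∀ n, |u n| ≤ B) :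
    IsBoundedUnder (· ≤ ·) atTop u :=
  isBoundedUnder_of ⟨B, fun n => (abs_le.1 (h n)).2⟩

theorem isBoundedUnder_ge_of_abs_le {u : ℕ → ℝ} {B : ℝ} (h : ∀ n, |u n| ≤ B) :
    IsBoundedUnder (· ≥ ·) atTop u :=
  isBoundedUnder_of ⟨-B, fun n => (abs_le.1 (h n)).1⟩

theorem limsup_le_limsup_of_tendsto_sub {u v : ℕ → ℝ} {B : ℝ} (hu : ∀ n, |u n| ≤ B)
    (hv : ∀ n, |v n| ≤ B) (h : Tendsto (fun n => u n - v n) atTop (𝓝 0)) :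
    limsup u atTop ≤ limsup v atTop := by
  refine le_of_forall_pos_le_add fun ε hε => ?_
  refine limsup_le_of_le (isBoundedUnder_ge_of_abs_le hu).isCoboundedUnder_le ?_
  have h1 : ∀ᶠ n in atTop, v n < limsup v atTop + ε / 2 :=
    eventually_lt_of_limsup_lt (by linarith) (isBoundedUnder_le_of_abs_le hv)
  have h2 : ∀ᶠ n in atTop, u n - v n < ε / 2 := h.eventually_lt_const (by linarith)
  filter_upwards [h1, h2] with n h1 h2
  linarith

/-- The averages started at `x` and at `T x` differ by two boundary terms divided by `n`, which
vanish in the limit. -/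
theorem limsup_birkhoffAverage_apply {B : ℝ} (hB : ∀ x, |f x| ≤ B) (x : Ω) :
    limsup (fun n => birkhoffAverage ℝ T f n (T x)) atTop =
      limsup (fun n => birkhoffAverage ℝ T f n x) atTop := by
  have hb : Bornology.IsBounded (Set.range f) := by
    refine (Metric.isBounded_closedBall (x := (0 : ℝ)) (r := B)).subset ?_
    rintro _ ⟨y, rfl⟩
    simpa using hB y
  have h := tendsto_birkhoffAverage_apply_sub_birkhoffAverage' ℝ hb T x
  refine le_antisymm ?_ ?_
  · exact limsup_le_limsup_of_tendsto_sub (fun n => abs_birkhoffAverage_le hB n _)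
      (fun n => abs_birkhoffAverage_le hB n _) h
  · refine limsup_le_limsup_of_tendsto_sub (fun n => abs_birkhoffAverage_le hB n _)
      (fun n => abs_birkhoffAverage_le hB n _) ?_
    simpa using h.neg

/-- The maximum of `0` and the first `n` Birkhoff sums of `f`. -/
noncomputable def maxBirkhoffSum (T : Ω → Ω) (f : Ω → ℝ) : ℕ → Ω → ℝ
  | 0, _ => 0
  | n + 1, x => max 0 (f x + maxBirkhoffSum T f n (T x))

theorem maxBirkhoffSum_nonneg (n : ℕ) (x : Ω) : 0 ≤ maxBirkhoffSum T f n x := by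
  cases n with
  | zero => exact le_rfl
  | succ n => exact le_max_left _ _

theorem maxBirkhoffSum_le_succ (n : ℕ) (x : Ω) :
    maxBirkhoffSum T f n x ≤ maxBirkhoffSum T f (n + 1) x := by
  induction n generalizing x with
  | zero => exact le_max_left _ _
  | succ n ih => exact max_le_max le_rfl (by linarith [ih (T x)])

theorem birkhoffSum_le_maxBirkhoffSum (n : ℕ) (x : Ω) :
    birkhoffSum T f n x ≤ maxBirkhoffSum T f n x := by
  induction n generalizing x with
  | zero => simp [maxBirkhoffSum]
  | succ n ih =>
    rw [birkhoffSum_succ']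
    exact le_max_of_le_right (by linarith [ih (T x)])

theorem abs_maxBirkhoffSum_le {B : ℝ} (hB : ∀ x, |f x| ≤ B) (n : ℕ) (x : Ω) :
    |maxBirkhoffSum T f n x| ≤ n * B := by
  have hB0 : 0 ≤ B := (abs_nonneg _).trans (hB x)
  rw [abs_of_nonneg (maxBirkhoffSum_nonneg n x)]
  induction n generalizing x with
  | zero => simp [maxBirkhoffSum]
  | succ n ih =>
    refine max_le (by positivity) ?_
    have := (abs_le.1 (hB x)).2
    have := ih (T x)
    push_cast
    linarith

variable [MeasurableSpace Ω] {μ : Measure Ω}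

theorem measurable_maxBirkhoffSum (hT : Measurable T) (hf : Measurable f) (n : ℕ) :
    Measurable (maxBirkhoffSum T f n) := by
  induction n with
  | zero => exact measurable_const
  | succ n ih => exact measurable_const.max (hf.add (ih.comp hT))

theorem integrable_of_abs_le [IsFiniteMeasure μ] {g : Ω → ℝ} (hg : Measurable g) {B : ℝ}
    (hB : ∀ x, |g x| ≤ B) : Integrable g μ :=
  Integrable.of_bound hg.aestronglyMeasurable B (Eventually.of_forall hB)

/-- The maximal ergodic theorem, for a bounded function having a positive Birkhoff sum
at every point. -/
theorem integral_nonneg_of_exists_birkhoffSum_pos [IsFiniteMeasure μ]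
    (hT : MeasurePreserving T μ μ) (hf : Measurable f) {B : ℝ} (hB : ∀ x, |f x| ≤ B)
    (hpos : ∀ x, ∃ n, 0 < birkhoffSum T f n x) : 0 ≤ ∫ x, f x ∂μ := by
  set M := maxBirkhoffSum T f with hM
  have hMm := measurable_maxBirkhoffSum hT.measurable hf
  have hset : ∀ n, MeasurableSet {x | 0 < M n x} := fun n =>
    measurableSet_lt measurable_const (hMm n)
  have hMi : ∀ n, Integrable (M n) μ := fun n =>
    integrable_of_abs_le (hMm n) (abs_maxBirkhoffSum_le hB n)
  have hMono : ∀ x, Monotone fun n => M n x := fun x =>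
    monotone_nat_of_le_succ fun n => maxBirkhoffSum_le_succ n x
  have key : ∀ n, 0 ≤ ∫ x, {x | 0 < M n x}.indicator f x ∂μ := by
    intro n
    have hcomp : ∫ x, M n (T x) ∂μ = ∫ x, M n x ∂μ := by
      conv_rhs => rw [← hT.map_eq]
      exact (integral_map hT.measurable.aemeasurable
        (hMm n).aestronglyMeasurable).symm
    have hci : Integrable (fun x => M n (T x)) μ := hT.integrable_comp_of_integrable (hMi n)
    have h0 : ∫ x, (M n x - M n (T x)) ∂μ = 0 := by
      rw [integral_sub (hMi n) hci, hcomp, sub_self]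
    -- Pointwise `M n - M n ∘ T` is at most `f` cut off to `{M n > 0}`: there the recursion and
    -- monotonicity give `M n ≤ f + M n ∘ T`; elsewhere `M n = 0 ≤ M n ∘ T`.
    refine h0.ge.trans ?_
    refine integral_mono ((hMi n).sub hci)
      ((integrable_of_abs_le hf hB).indicator (hset n)) fun x => ?_
    by_cases hx : 0 < M n x
    · simp only [Set.indicator, Set.mem_ofPred_eq, hx, if_true]
      cases n with
      | zero => exact absurd hx (lt_irrefl _)
      | succ n =>
        have h1 : M (n + 1) x = max 0 (f x + M n (T x)) := rfl
        have h2 : M n (T x) ≤ M (n + 1) (T x) := hMono (T x) n.le_succ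
        rcases max_cases 0 (f x + M n (T x)) with h | h <;> linarith
    · simp only [Set.indicator, Set.mem_ofPred_eq, hx, if_false]
      have := maxBirkhoffSum_nonneg (T := T) (f := f) n (T x)
      linarith
  have hlim : Tendsto (fun n => ∫ x, {x | 0 < M n x}.indicator f x ∂μ) atTop
      (𝓝 (∫ x, f x ∂μ)) := by
    refine tendsto_integral_of_dominated_convergence (fun _ => B)
      (fun n => (hf.indicator (hset n)).aestronglyMeasurable) (integrable_const B) ?_ ?_
    · refine fun n => Eventually.of_forall fun x => ?_
      exact (norm_indicator_le_norm_self f x).trans (hB x)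
    · refine Eventually.of_forall fun x => ?_
      obtain ⟨n, hn⟩ := hpos x
      refine tendsto_const_nhds.congr' ?_
      filter_upwards [eventually_ge_atTop n] with k hk
      have : 0 < M k x := (hn.trans_le (birkhoffSum_le_maxBirkhoffSum n x)).trans_le (hMono x hk)
      simp [Set.indicator, this]
  exact ge_of_tendsto' hlim key

theorem measurable_birkhoffAverage (hT : Measurable T) (hf : Measurable f) (n : ℕ) :
    Measurable (birkhoffAverage ℝ T f n) := by
  unfold birkhoffAverage birkhoffSum
  exact (Finset.measurable_sum _ fun k _ => hf.comp (hT.iterate k)).const_mul _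

/-- The limsup `F` is `T`-invariant, so the `n`-th Birkhoff sum of `f - F + ε` is `n` times (average
of `f`, minus `F`, plus `ε`). This is positive for some `n` at every point, and the maximal ergodic
theorem applies. -/
theorem integral_limsup_birkhoffAverage_le [IsProbabilityMeasure μ]
    (hT : MeasurePreserving T μ μ) (hf : Measurable f) {B : ℝ} (hB : ∀ x, |f x| ≤ B) :
    ∫ x, limsup (fun n => birkhoffAverage ℝ T f n x) atTop ∂μ ≤ ∫ x, f x ∂μ := by
  set F : Ω → ℝ := fun x => limsup (fun n => birkhoffAverage ℝ T f n x) atTop with hF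
  have hFm : Measurable F :=
    Measurable.limsup fun n => measurable_birkhoffAverage hT.measurable hf n
  have hFB : ∀ x, |F x| ≤ B := fun x => by
    have h := fun n => abs_birkhoffAverage_le (T := T) hB n x
    refine abs_le.2 ⟨?_, ?_⟩
    · exact le_limsup_of_le (isBoundedUnder_le_of_abs_le h) fun b hb =>
        let ⟨n, hn⟩ := hb.exists
        (abs_le.1 (h n)).1.trans hn
    · exact limsup_le_of_le (isBoundedUnder_ge_of_abs_le h).isCoboundedUnder_le
        (Eventually.of_forall fun n => (abs_le.1 (h n)).2)
  have hFT : F ∘ T = F := funext fun x => limsup_birkhoffAverage_apply hB x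
  refine le_of_forall_pos_le_add fun ε hε => ?_
  have h := integral_nonneg_of_exists_birkhoffSum_pos (f := fun x => f x - F x + ε)
    (B := B + B + ε) hT ((hf.sub hFm).add_const ε) (fun x => ?_) (fun x => ?_)
  · have hfi : Integrable f μ := integrable_of_abs_le hf hB
    have hFi : Integrable F μ := integrable_of_abs_le hFm hFB
    have h1 : ∫ x, (f x - F x + ε) ∂μ = ∫ x, f x ∂μ - ∫ x, F x ∂μ + ε := by
      rw [integral_add (f := fun x => f x - F x) (hfi.sub hFi) (integrable_const ε),
        integral_sub hfi hFi]
      simp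
    linarith
  · have h1 := abs_le.1 (hB x)
    have h2 := abs_le.1 (hFB x)
    exact abs_le.2 ⟨by linarith, by linarith⟩
  · have hfreq : ∃ᶠ n in atTop, F x - ε < birkhoffAverage ℝ T f n x :=
      frequently_lt_of_lt_limsup (isBoundedUnder_ge_of_abs_le
        fun n => abs_birkhoffAverage_le hB n x).isCoboundedUnder_le (by linarith)
    obtain ⟨n, hn, hn1⟩ := (hfreq.and_eventually (eventually_ge_atTop 1)).exists
    refine ⟨n, ?_⟩
    have hn0 : (0 : ℝ) < n := by exact_mod_cast hn1
    have hFk : ∀ k, F (T^[k] x) = F x := fun k => by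
      induction k with
      | zero => rfl
      | succ k ih => rw [Function.iterate_succ_apply', ← ih]; exact congrFun hFT _
    have : birkhoffSum T (fun x => f x - F x + ε) n x =
        birkhoffSum T f n x - n * (F x - ε) := by
      simp only [birkhoffSum, Finset.sum_add_distrib, Finset.sum_sub_distrib, hFk,
        Finset.sum_const, Finset.card_range, nsmul_eq_mul]
      ring
    rw [this, sub_pos]
    rw [birkhoffAverage, smul_eq_mul, lt_inv_mul_iff₀ hn0] at hn
    exact hn

/-- Birkhoff's pointwise ergodic theorem for bounded measurable functions. -/
theorem ae_exists_tendsto_birkhoffAverage [IsProbabilityMeasure μ]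
    (hT : MeasurePreserving T μ μ) (hf : Measurable f) {B : ℝ} (hB : ∀ x, |f x| ≤ B) :
    ∀ᵐ x ∂μ, ∃ l, Tendsto (fun n => birkhoffAverage ℝ T f n x) atTop (𝓝 l) := by
  set F : Ω → ℝ := fun x => limsup (fun n => birkhoffAverage ℝ T f n x) atTop with hF
  set G : Ω → ℝ := fun x => liminf (fun n => birkhoffAverage ℝ T f n x) atTop with hG
  have h := fun n x => abs_birkhoffAverage_le (T := T) hB n x
  have hGF : ∀ x, G x ≤ F x := fun x =>
    liminf_le_limsup (isBoundedUnder_le_of_abs_le fun n => h n x)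
      (isBoundedUnder_ge_of_abs_le fun n => h n x)
  have hFm : Measurable F :=
    Measurable.limsup fun n => measurable_birkhoffAverage hT.measurable hf n
  have hGm : Measurable G :=
    Measurable.liminf fun n => measurable_birkhoffAverage hT.measurable hf n
  have hFB : ∀ x, F x ≤ B := fun x =>
    limsup_le_of_le (isBoundedUnder_ge_of_abs_le fun n => h n x).isCoboundedUnder_le
        (Eventually.of_forall fun n => (abs_le.1 (h n x)).2)
  have hGB : ∀ x, -B ≤ G x := fun x =>
    le_liminf_of_le (isBoundedUnder_le_of_abs_le fun n => h n x).isCoboundedUnder_ge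
        (Eventually.of_forall fun n => (abs_le.1 (h n x)).1)
  have hFi : Integrable F μ := integrable_of_abs_le hFm fun x =>
    abs_le.2 ⟨(hGB x).trans (hGF x), hFB x⟩
  have hGi : Integrable G μ := integrable_of_abs_le hGm fun x =>
    abs_le.2 ⟨hGB x, (hGF x).trans (hFB x)⟩
  have h1 : ∫ x, F x ∂μ ≤ ∫ x, f x ∂μ := integral_limsup_birkhoffAverage_le hT hf hB
  -- The same bound for `-f`. With `h1` it squeezes `∫ F ≤ ∫ G`, and since `G ≤ F` the two agree
  -- almost everywhere.
  have h2 : ∫ x, f x ∂μ ≤ ∫ x, G x ∂μ := by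
    have := integral_limsup_birkhoffAverage_le (f := -f) hT hf.neg
      (fun x => (abs_neg (f x)).trans_le (hB x))
    have hneg : ∀ x, limsup (fun n => birkhoffAverage ℝ T (-f) n x) atTop = -G x := by
      intro x
      have : (fun n => birkhoffAverage ℝ T (-f) n x) =
          fun n => -birkhoffAverage ℝ T f n x := by
        funext n
        simp [birkhoffAverage_neg]
      rw [this]
      exact ((OrderIso.neg ℝ).liminf_apply (isBoundedUnder_ge_of_abs_le fun n => h n x)
        (isBoundedUnder_le_of_abs_le fun n => h n x).isCoboundedUnder_ge
        (isBoundedUnder_le_of_abs_le fun n => (abs_neg _).trans_le (h n x))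
        (isBoundedUnder_ge_of_abs_le fun n =>
          (abs_neg _).trans_le (h n x)).isCoboundedUnder_le).symm
    simp only [hneg, Pi.neg_apply, integral_neg] at this
    linarith
  have h3 : ∫ x, (F x - G x) ∂μ = 0 := by
    refine le_antisymm ?_ (integral_nonneg fun x => sub_nonneg.2 (hGF x))
    rw [integral_sub hFi hGi]
    linarith
  have h4 := (integral_eq_zero_iff_of_nonneg (fun x => sub_nonneg.2 (hGF x)) (hFi.sub hGi)).1 h3
  filter_upwards [h4] with x hx
  have hx : F x - G x = 0 := hx
  exact ⟨F x, tendsto_of_liminf_eq_limsup (by change G x = F x; linarith) rfl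
    (isBoundedUnder_le_of_abs_le fun n => h n x)
    (isBoundedUnder_ge_of_abs_le fun n => h n x)⟩

end Birkhoff

/-! ### Invariant measures of continuous maps on compact sets. -/

section KrylovBogoliubov

open scoped ENNReal BoundedContinuousFunction

/-- The empirical probability measure of the first `n + 1` points of the orbit of `x`. -/
noncomputable def orbitMeasure {K : Type*} [MeasurableSpace K] (T : K → K) (x : K) (n : ℕ) :
    Measure K :=
  ((n + 1 : ℕ) : ℝ≥0∞)⁻¹ • ∑ k ∈ Finset.range (n + 1), Measure.dirac (T^[k] x)

instance isProbabilityMeasure_orbitMeasure {K : Type*} [MeasurableSpace K] (T : K → K) (x : K)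
    (n : ℕ) : IsProbabilityMeasure (orbitMeasure T x n) := by
  constructor
  simp only [orbitMeasure, Measure.smul_apply, Measure.coe_finsetSum, Finset.sum_apply,
    measure_univ, Finset.sum_const, Finset.card_range, smul_eq_mul, nsmul_eq_mul, mul_one]
  exact ENNReal.inv_mul_cancel (by simp) (ENNReal.natCast_ne_top _)

theorem integral_orbitMeasure {K : Type*} [TopologicalSpace K] [MeasurableSpace K] [BorelSpace K]
    (T : K → K) (x : K) (n : ℕ) (f : K →ᵇ ℝ) :
    ∫ y, f y ∂orbitMeasure T x n = birkhoffAverage ℝ T f (n + 1) x := by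
  have hm : StronglyMeasurable f := f.continuous.measurable.stronglyMeasurable
  rw [orbitMeasure, integral_smul_measure, integral_finsetSum_measure
    fun k _ => f.integrable _]
  simp only [integral_dirac' _ _ hm]
  simp [birkhoffAverage, birkhoffSum, -Nat.cast_add]

/-- The Krylov–Bogoliubov theorem. -/
theorem exists_measure_map_eq_self {K : Type*} [TopologicalSpace K] [CompactSpace K]
    [T2Space K] [SecondCountableTopology K]
    [MeasurableSpace K] [BorelSpace K] [Nonempty K] {T : K → K} (hT : Continuous T) :
    ∃ μ : Measure K, IsProbabilityMeasure μ ∧ μ.map T = μ := by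
  obtain ⟨x⟩ := ‹Nonempty K›
  let ν : ℕ → ProbabilityMeasure K := fun n => ⟨orbitMeasure T x n, inferInstance⟩
  -- Compactness of the space of probability measures gives the empirical measures a limit along a
  -- free ultrafilter, with no need to extract a subsequence.
  let U : Ultrafilter ℕ := Filter.hyperfilter ℕ
  have hU : (U : Filter ℕ) ≤ atTop := by
    rw [← Nat.cofinite_eq_atTop]; exact Filter.hyperfilter_le_cofinite
  obtain ⟨μ, -, hμ⟩ := isCompact_univ.ultrafilter_le_nhds (U.map ν) (by simp)
  have hlim : Tendsto ν U (𝓝 μ) := hμ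
  rw [ProbabilityMeasure.tendsto_iff_forall_integral_tendsto] at hlim
  refine ⟨μ, inferInstance, ?_⟩
  have : IsProbabilityMeasure ((μ : Measure K).map T) :=
    Measure.isProbabilityMeasure_map hT.measurable.aemeasurable
  refine ext_of_forall_integral_eq_of_IsFiniteMeasure fun f => ?_
  rw [integral_map hT.measurable.aemeasurable f.continuous.measurable.aestronglyMeasurable]
  have h1 := hlim f
  have h2 := hlim (f.compContinuous ⟨T, hT⟩)
  -- The averages of `f ∘ T` and of `f` along the orbit differ by a null sequence, so the limit
  -- measure gives both the same integral.
  have h3 := (tendsto_birkhoffAverage_apply_sub_birkhoffAverage' ℝ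
    f.isBounded_range T x).comp ((tendsto_add_atTop_nat 1).mono_left hU)
  refine tendsto_nhds_unique h2 ?_
  have h4 := h1.add h3
  rw [add_zero] at h4
  refine h4.congr fun n => ?_
  change ∫ y, f y ∂orbitMeasure T x n + (birkhoffAverage ℝ T f (n + 1) (T x) -
    birkhoffAverage ℝ T f (n + 1) x) = ∫ y, (f.compContinuous ⟨T, hT⟩) y ∂orbitMeasure T x n
  rw [integral_orbitMeasure, integral_orbitMeasure]
  rw [add_sub_cancel]
  refine congrArg _ (Finset.sum_congr rfl fun k _ => congrArg f ?_)
  rw [← Function.iterate_succ_apply, Function.iterate_succ_apply']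
  rfl

/-- A measurable map which is continuous on a nonempty compact set that it maps to itself has an
invariant probability measure carried by this set. -/
theorem exists_measurePreserving_of_mapsTo {E : Type*} [TopologicalSpace E]
    [T2Space E] [SecondCountableTopology E] [MeasurableSpace E] [BorelSpace E]
    {T : E → E} (hTm : Measurable T) {K : Set E} (hK : IsCompact K) (hne : K.Nonempty)
    (hmaps : Set.MapsTo T K K) (hcont : ContinuousOn T K) :
    ∃ μ : Measure E, IsProbabilityMeasure μ ∧ (∀ᵐ w ∂μ, w ∈ K) ∧ MeasurePreserving T μ μ := by
  have : CompactSpace K := isCompact_iff_compactSpace.1 hK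
  have : Nonempty K := hne.to_subtype
  obtain ⟨μ, hμ, hinv⟩ := exists_measure_map_eq_self (T := hmaps.restrict T K K)
    (hcont.mapsToRestrict hmaps)
  have hcm : Measurable (Subtype.val : K → E) := measurable_subtype_coe
  refine ⟨μ.map Subtype.val, Measure.isProbabilityMeasure_map hcm.aemeasurable, ?_, hTm, ?_⟩
  · refine (ae_map_iff (p := fun w => w ∈ K) hcm.aemeasurable hK.measurableSet).2 ?_
    exact Eventually.of_forall fun w => w.2
  · rw [Measure.map_map hTm hcm]
    conv_rhs => rw [← hinv]
    rw [Measure.map_map hcm (hcont.mapsToRestrict hmaps).measurable]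
    rfl

end KrylovBogoliubov

namespace AdaBoost

variable {m : ℕ} {M : Finset (Row m)} {sel : Finset (Row m) → Row m} {η η' : Row m}
  {w : Fin m → ℝ}

/-! ### Effect of one update on weights and errors. -/

section ErrorAndUpdate

theorem continuous_err (η : Row m) : Continuous (err η) := by
  unfold err
  fun_prop

theorem row_eq_zero_or_one (η : Row m) (i : Fin m) : η i = 0 ∨ η i = 1 := by
  have := (η i).isLt
  rcases h : η i with ⟨k, hk⟩
  interval_cases k
  · exact Or.inl rfl
  · exact Or.inr rfl

theorem err_nonneg (hw : ∀ i, 0 ≤ w i) : 0 ≤ err η w :=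
  Finset.sum_nonneg fun i _ => mul_nonneg (Nat.cast_nonneg _) (hw i)

theorem le_err (hw : ∀ i, 0 ≤ w i) {i : Fin m} (hi : η i = 1) : w i ≤ err η w := by
  have h := Finset.single_le_sum (f := fun i => ((η i : ℕ) : ℝ) * w i)
    (fun i _ => mul_nonneg (Nat.cast_nonneg _) (hw i)) (Finset.mem_univ i)
  simpa [hi, err] using h

theorem hypUpdate_of_eq_one {i : Fin m} (hi : η i = 1) :
    hypUpdate η w i = w i / (2 * err η w) := by
  simp [hypUpdate, hi]
  ring

theorem hypUpdate_of_eq_zero {i : Fin m} (hi : η i = 0) :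
    hypUpdate η w i = w i / (2 * (1 - err η w)) := by
  rw [div_eq_mul_inv, mul_inv]
  simp only [hypUpdate, hi, Fin.val_zero, pow_zero, Nat.sub_zero, pow_one, one_div]
  ring

theorem err_hypUpdate_self (h : 0 < err η w) : err η (hypUpdate η w) = 1 / 2 := by
  have h1 : err η (hypUpdate η w) = ∑ i, ((η i : ℕ) : ℝ) * w i / (2 * err η w) := by
    refine Finset.sum_congr rfl fun i _ => ?_
    rcases row_eq_zero_or_one η i with hi | hi
    · simp [hi]
    · rw [hypUpdate_of_eq_one hi, mul_div_assoc]
  rw [h1, ← Finset.sum_div]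
  change err η w / (2 * err η w) = 1 / 2
  field_simp

/-- Both possible denominators, `2 * err η w` and `2 * (1 - err η w)`, are at most 2. -/
theorem half_le_hypUpdate (hw : ∀ i, 0 ≤ w i) (h0 : 0 < err η w) (h1 : err η w < 1)
    (i : Fin m) : w i / 2 ≤ hypUpdate η w i := by
  rcases row_eq_zero_or_one η i with hi | hi
  · rw [hypUpdate_of_eq_zero hi]
    exact div_le_div_of_nonneg_left (hw i) (by linarith) (by linarith)
  · rw [hypUpdate_of_eq_one hi]
    exact div_le_div_of_nonneg_left (hw i) (by linarith) (by linarith)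

theorem hypUpdate_mem_stdSimplex (hw : w ∈ stdSimplex ℝ (Fin m)) (h0 : 0 < err η w)
    (h1 : err η w < 1) : hypUpdate η w ∈ stdSimplex ℝ (Fin m) := by
  refine ⟨fun i => (div_nonneg (hw.1 i) zero_le_two).trans (half_le_hypUpdate hw.1 h0 h1 i), ?_⟩
  have h : ∀ i, hypUpdate η w i = ((η i : ℕ) : ℝ) * w i / (2 * err η w) +
      (w i - ((η i : ℕ) : ℝ) * w i) / (2 * (1 - err η w)) := fun i => by
    rcases row_eq_zero_or_one η i with hi | hi
    · rw [hypUpdate_of_eq_zero hi]; simp [hi]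
    · rw [hypUpdate_of_eq_one hi]; simp [hi]
  simp only [h]
  rw [Finset.sum_add_distrib, ← Finset.sum_div, ← Finset.sum_div, Finset.sum_sub_distrib, hw.2]
  change err η w / (2 * err η w) + (1 - err η w) / (2 * (1 - err η w)) = 1
  have : 1 - err η w ≠ 0 := by linarith
  field_simp
  norm_num

theorem err_le_two_mul_err_hypUpdate (hw : ∀ i, 0 ≤ w i) (h0 : 0 < err η w)
    (h1 : err η w < 1) : err η' w ≤ 2 * err η' (hypUpdate η w) := by
  rw [err, err, Finset.mul_sum]
  refine Finset.sum_le_sum fun i _ => ?_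
  have h := half_le_hypUpdate hw h0 h1 i
  nlinarith [Nat.cast_nonneg (α := ℝ) (η' i : ℕ)]

end ErrorAndUpdate

/-! ### The selected best row and weak learning. -/

section BestRow

theorem argminRows_subset : argminRows M w ⊆ M := Finset.filter_subset _ _

theorem mem_argminRows : η ∈ argminRows M w ↔ η ∈ M ∧ ∀ η' ∈ M, err η w ≤ err η' w := by
  simp [argminRows]

theorem bestRow_mem_argminRows (hsel : IsTieBreaking M sel) (hM : M.Nonempty)
    (w : Fin m → ℝ) : bestRow M sel w ∈ argminRows M w := by
  refine hsel _ argminRows_subset ?_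
  obtain ⟨η, hη, h⟩ := M.exists_min_image (fun η => err η w) hM
  exact ⟨η, mem_argminRows.2 ⟨hη, h⟩⟩

theorem bestRow_mem (hsel : IsTieBreaking M sel) (hM : M.Nonempty) (w : Fin m → ℝ) :
    bestRow M sel w ∈ M :=
  argminRows_subset (bestRow_mem_argminRows hsel hM w)

theorem err_bestRow_le (hsel : IsTieBreaking M sel) (hη : η ∈ M) (w : Fin m → ℝ) :
    err (bestRow M sel w) w ≤ err η w :=
  (mem_argminRows.1 (bestRow_mem_argminRows hsel ⟨η, hη⟩ w)).2 η hη

theorem eps_eq_err_bestRow (hsel : IsTieBreaking M sel) (hM : M.Nonempty) (w : Fin m → ℝ) :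
    eps M w = err (bestRow M sel w) w := by
  refine IsLeast.csInf_eq ⟨⟨_, bestRow_mem hsel hM w, rfl⟩, ?_⟩
  rintro _ ⟨η, hη, rfl⟩
  exact err_bestRow_le hsel hη w

theorem WeakLearnable.err_bestRow_lt_half (hweak : WeakLearnable M) (hsel : IsTieBreaking M sel)
    (hw : w ∈ stdSimplex ℝ (Fin m)) : err (bestRow M sel w) w < 1 / 2 := by
  obtain ⟨γ, hγ, h⟩ := hweak
  obtain ⟨η, hη, hlt⟩ := h w hw
  linarith [err_bestRow_le hsel hη w]

theorem WeakLearnable.nonempty (hweak : WeakLearnable M) (hw : w ∈ stdSimplex ℝ (Fin m)) :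
    M.Nonempty := by
  obtain ⟨γ, -, h⟩ := hweak
  obtain ⟨η, hη, -⟩ := h w hw
  exact ⟨η, hη⟩

end BestRow

/-! ### Uniform lower bound for the errors after `m + 1` rounds. -/

section LowerBound

variable (hsel : IsTieBreaking M sel) (hweak : WeakLearnable M)
include hsel hweak

theorem err_bestRow_mem_Ioo (hw : w ∈ sigmaZero M) :
    0 < err (bestRow M sel w) w ∧ err (bestRow M sel w) w < 1 := by
  refine ⟨hw.2 _ (bestRow_mem hsel (hweak.nonempty hw.1) w), ?_⟩
  linarith [hweak.err_bestRow_lt_half hsel hw.1]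

theorem mapsTo_update_sigmaZero :
    Set.MapsTo (update M sel) (sigmaZero M) (sigmaZero M) := by
  intro w hw
  obtain ⟨h0, h1⟩ := err_bestRow_mem_Ioo hsel hweak hw
  refine ⟨hypUpdate_mem_stdSimplex hw.1 h0 h1, fun η hη => ?_⟩
  have h : err η w ≤ 2 * err η (update M sel w) := err_le_two_mul_err_hypUpdate hw.1.1 h0 h1
  linarith [hw.2 η hη]

theorem iterate_update_mem_sigmaZero (hw : w ∈ sigmaZero M) (n : ℕ) :
    (update M sel)^[n] w ∈ sigmaZero M :=
  (mapsTo_update_sigmaZero hsel hweak).iterate n hw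

theorem apply_le_two_pow_mul_iterate_update (hw : w ∈ sigmaZero M) (n : ℕ) (i : Fin m) :
    w i ≤ 2 ^ n * (update M sel)^[n] w i := by
  induction n with
  | zero => simp
  | succ n ih =>
    have hn := iterate_update_mem_sigmaZero hsel hweak hw n
    obtain ⟨h0, h1⟩ := err_bestRow_mem_Ioo hsel hweak hn
    have h : (update M sel)^[n] w i / 2 ≤ (update M sel)^[n + 1] w i := by
      rw [Function.iterate_succ_apply']
      exact half_le_hypUpdate hn.1.1 h0 h1 i
    refine ih.trans ?_
    rw [pow_succ, mul_assoc]
    exact mul_le_mul_of_nonneg_left (by linarith) (by positivity)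

theorem err_le_two_pow_mul_err_iterate_update (hw : w ∈ sigmaZero M) (n : ℕ) :
    err η w ≤ 2 ^ n * err η ((update M sel)^[n] w) := by
  rw [err, err, Finset.mul_sum]
  refine Finset.sum_le_sum fun i _ => ?_
  have h := apply_le_two_pow_mul_iterate_update hsel hweak hw n i
  calc _ ≤ ((η i : ℕ) : ℝ) * (2 ^ n * (update M sel)^[n] w i) :=
        mul_le_mul_of_nonneg_left h (Nat.cast_nonneg _)
    _ = _ := by ring

/-- After an update, some example misclassified by the row just used has weight at least
`1 / (2 * m)`. -/
theorem exists_misclassified_le_update (hw : w ∈ sigmaZero M) :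
    ∃ i, bestRow M sel w i = 1 ∧ 1 / (2 * m : ℝ) ≤ update M sel w i := by
  by_contra! hcon
  obtain ⟨h0, h1⟩ := err_bestRow_mem_Ioo hsel hweak hw
  have hhalf : err (bestRow M sel w) (update M sel w) = 1 / 2 := err_hypUpdate_self h0
  have hm : 0 < m := by
    rcases m.eq_zero_or_pos with rfl | hm
    · simp [err] at h0
    · exact hm
  have : Nonempty (Fin m) := ⟨⟨0, hm⟩⟩
  have hm' : (0 : ℝ) < m := by exact_mod_cast hm
  have hlt : err (bestRow M sel w) (update M sel w) < ∑ _i : Fin m, 1 / (2 * m : ℝ) := by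
    refine Finset.sum_lt_sum_of_nonempty Finset.univ_nonempty fun i _ => ?_
    rcases row_eq_zero_or_one (bestRow M sel w) i with hi | hi
    · rw [hi]; simp; exact hm
    · have := hcon i hi
      rw [hi]; simpa using this
  rw [hhalf] at hlt
  simp at hlt
  field_simp at hlt
  norm_num at hlt

/-- A lower bound, uniform over `σ₀`, of all errors after `m + 1` rounds. -/
noncomputable def errorBound (m : ℕ) : ℝ := 1 / (2 ^ (m + 1) * 2 ^ (m + 1) * (2 * m))

omit hsel hweak in
theorem errorBound_pos (hw : w ∈ stdSimplex ℝ (Fin m)) : 0 < errorBound m := by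
  have hm : 0 < m := by
    rcases m.eq_zero_or_pos with rfl | hm
    · simpa using hw.2
    · exact hm
  unfold errorBound
  positivity

/-- If an error were too small after `m + 1` rounds, the examples on which the `m + 1` selected
rows err would have to be distinct. -/
theorem errorBound_le_err_iterate_update (hw : w ∈ sigmaZero M) (hη : η ∈ M) :
    errorBound m ≤ err η ((update M sel)^[m + 1] w) := by
  by_contra! hcon
  have hc := errorBound_pos hw.1
  have hm : (0 : ℝ) < m := by
    by_contra! h
    have : (m : ℝ) = 0 := le_antisymm h (Nat.cast_nonneg _)
    simp [errorBound, this] at hc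
  set W : ℕ → Fin m → ℝ := fun k => (update M sel)^[k] w with hW
  have hWmem : ∀ k, W k ∈ sigmaZero M := iterate_update_mem_sigmaZero hsel hweak hw
  have hWadd : ∀ k n, (update M sel)^[n] (W k) = W (n + k) := fun k n =>
    (Function.iterate_add_apply _ n k w).symm
  -- Of the two factors `2 ^ (m + 1)` in `errorBound`, one is spent here, carrying the small error
  -- back from round `m + 1` to round `k`. The other is spent in `hne`, carrying a large weight
  -- forward.
  have hsmall : ∀ k ≤ m, err (bestRow M sel (W k)) (W k) < 1 / (2 ^ (m + 1) * (2 * m)) := by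
    intro k hk
    have h1 := err_bestRow_le hsel hη (W k)
    have h2 := err_le_two_pow_mul_err_iterate_update (η := η) hsel hweak (hWmem k) (m + 1 - k)
    rw [hWadd, Nat.sub_add_cancel (by omega)] at h2
    have h3 : (2 : ℝ) ^ (m + 1 - k) * err η (W (m + 1)) ≤ 2 ^ (m + 1) * err η (W (m + 1)) :=
      mul_le_mul_of_nonneg_right (pow_le_pow_right₀ one_le_two (Nat.sub_le _ _))
        (err_nonneg (hWmem _).1.1)
    have h4 : (2 : ℝ) ^ (m + 1) * err η (W (m + 1)) < 2 ^ (m + 1) * errorBound m :=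
      mul_lt_mul_of_pos_left hcon (by positivity)
    have h5 : (2 : ℝ) ^ (m + 1) * errorBound m = 1 / (2 ^ (m + 1) * (2 * m)) := by
      unfold errorBound
      field_simp
    linarith
  choose i hi1 hi2 using fun k => exists_misclassified_le_update hsel hweak (hWmem k)
  -- Example `i k` has weight at least `1 / (2 * m)` after round `k` and loses at most half of it
  -- per round. At time `l` it still outweighs the whole error of the best row, so that row is right
  -- on `i k` but wrong on `i l`.
  have hne : ∀ k l, k < l → l ≤ m → i k ≠ i l := by
    intro k l hkl hl heq
    have h1 := hi2 k
    have h2 := apply_le_two_pow_mul_iterate_update hsel hweak (hWmem (k + 1)) (l - (k + 1)) (i k)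
    rw [hWadd, Nat.sub_add_cancel (by omega)] at h2
    have h3 : W l (i k) ≤ err (bestRow M sel (W l)) (W l) :=
      le_err (hWmem l).1.1 (by rw [heq]; exact hi1 l)
    have h4 : update M sel (W k) = W (k + 1) := (Function.iterate_succ_apply' _ k w).symm
    rw [h4] at h1
    have h5 : (2 : ℝ) ^ (l - (k + 1)) * W l (i k) ≤ 2 ^ (m + 1) * W l (i k) :=
      mul_le_mul_of_nonneg_right (pow_le_pow_right₀ one_le_two (by omega)) ((hWmem l).1.1 _)
    have h6 : 1 / (2 * m : ℝ) ≤ 2 ^ (m + 1) * W l (i k) := by linarith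
    have h7 : 1 / (2 ^ (m + 1) * (2 * m : ℝ)) ≤ W l (i k) := by
      rw [mul_comm (2 ^ (m + 1)), ← div_div, div_le_iff₀ (by positivity), mul_comm _ (2 ^ (m + 1))]
      exact h6
    linarith [hsmall l hl]
  -- Pigeonhole: `m + 1` distinct examples among `m`.
  have hinj : Function.Injective fun k : Fin (m + 1) => i k := by
    intro k l hkl
    by_contra hne'
    rcases lt_or_gt_of_ne hne' with h | h
    · exact hne k l h (by omega) hkl
    · exact hne l k h (by omega) hkl.symm
  have := Fintype.card_le_of_injective _ hinj
  simp at this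

end LowerBound

end AdaBoost

namespace AdaBoost

variable {m : ℕ} {M : Finset (Row m)} {sel : Finset (Row m) → Row m} {η η' : Row m}
  {w : Fin m → ℝ}

/-! ### Measurability of the dynamics. -/

section Measurability

theorem measurableSet_argminRows_eq (E : Finset (Row m)) :
    MeasurableSet {w | argminRows M w = E} := by
  have h : {w | argminRows M w = E} =
      ⋂ η : Row m, {w | (η ∈ M ∧ ∀ η' ∈ M, err η w ≤ err η' w) ↔ η ∈ E} := by
    ext w
    simp [Finset.ext_iff, mem_argminRows]
  rw [h]
  refine MeasurableSet.iInter fun η => ?_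
  refine measurableSet_setOfPred.2 (Measurable.iff (measurable_const.and ?_) measurable_const)
  refine Measurable.forall fun η' => measurable_const.imp ?_
  exact measurableSet_setOfPred.1
    (measurableSet_le (continuous_err η).measurable (continuous_err η').measurable)

/-- However arbitrary the tie-breaking is, the row depends on `w` only through the argmin set, which
takes finitely many values on measurable pieces. -/
theorem measurable_bestRow (M : Finset (Row m)) (sel : Finset (Row m) → Row m) :
    Measurable (bestRow M sel) := by
  refine measurable_to_countable' fun η => ?_
  have h : bestRow M sel ⁻¹' {η} =
      ⋃ E : Finset (Row m), ⋃ _ : sel E = η, {w | argminRows M w = E} := by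
    ext w
    simp [bestRow]
  rw [h]
  exact MeasurableSet.iUnion fun E => MeasurableSet.iUnion fun _ => measurableSet_argminRows_eq E

theorem measurable_hypUpdate (η : Row m) : Measurable (hypUpdate η) := by
  have h := (continuous_err η).measurable
  refine measurable_pi_lambda _ fun i => ?_
  unfold hypUpdate
  fun_prop

theorem measurable_update (M : Finset (Row m)) (sel : Finset (Row m) → Row m) :
    Measurable (update M sel) := by
  have h : Measurable fun p : Row m × (Fin m → ℝ) => hypUpdate p.1 p.2 :=
    measurable_from_prod_countable_right fun η => measurable_hypUpdate η
  exact h.comp ((measurable_bestRow M sel).prodMk measurable_id)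

theorem measurable_err_bestRow (M : Finset (Row m)) (sel : Finset (Row m) → Row m) :
    Measurable fun w => err (bestRow M sel w) w := by
  have h : Measurable (Function.uncurry (err (m := m))) :=
    measurable_from_prod_countable_right fun η => (continuous_err η).measurable
  have h' : Measurable fun w : Fin m → ℝ => (bestRow M sel w, w) :=
    (measurable_bestRow M sel).prodMk measurable_id
  exact h.comp h'

theorem measurable_alpha (hsel : IsTieBreaking M sel) (hM : M.Nonempty) :
    Measurable (alpha M) := by
  have h := measurable_err_bestRow M sel
  unfold alpha
  simp only [eps_eq_err_bestRow hsel hM]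
  fun_prop

theorem measurableSet_sigmaStar (η : Row m) : MeasurableSet (sigmaStar M sel η) := by
  have h : sigmaStar M sel η = stdSimplex ℝ (Fin m) ∩ bestRow M sel ⁻¹' {η} := by
    ext w
    simp [sigmaStar, eq_comm]
  rw [h]
  exact (isCompact_stdSimplex ℝ (Fin m)).measurableSet.inter
    (measurable_bestRow M sel (measurableSet_singleton η))

/-- The weights for which every row has error at least `c`. -/
def errGe (M : Finset (Row m)) (c : ℝ) : Set (Fin m → ℝ) :=
  {w | w ∈ stdSimplex ℝ (Fin m) ∧ ∀ η ∈ M, c ≤ err η w}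

theorem isClosed_errGe (M : Finset (Row m)) (c : ℝ) : IsClosed (errGe M c) := by
  have h : errGe M c = stdSimplex ℝ (Fin m) ∩ ⋂ η ∈ M, {w | c ≤ err η w} := by
    ext w
    simp [errGe]
  rw [h]
  exact (isCompact_stdSimplex ℝ (Fin m)).isClosed.inter
    (isClosed_biInter fun η _ => isClosed_le continuous_const (continuous_err η))

theorem mapsTo_iterate_update_errGe (hsel : IsTieBreaking M sel) (hweak : WeakLearnable M) :
    Set.MapsTo (update M sel)^[m + 1] (sigmaZero M) (errGe M (errorBound m)) := fun _ hw =>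
  ⟨(iterate_update_mem_sigmaZero hsel hweak hw _).1, fun _ hη =>
    errorBound_le_err_iterate_update hsel hweak hw hη⟩

end Measurability

/-! ### Continuity of the update where ties are harmless. -/

section Continuity

theorem continuousAt_hypUpdate (h0 : err η w ≠ 0) (h1 : err η w ≠ 1) :
    ContinuousAt (hypUpdate η) w := by
  have h := (continuous_err η).continuousAt (x := w)
  refine continuousAt_pi.2 fun i => ?_
  unfold hypUpdate
  have h2 : 1 - err η w ≠ 0 := sub_ne_zero.2 h1.symm
  have h3 : ContinuousAt (fun v => 1 / err η v) w := continuousAt_const.div h h0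
  have h4 : ContinuousAt (fun v => 1 / (1 - err η v)) w :=
    continuousAt_const.div (continuousAt_const.sub h) h2
  exact ((continuousAt_const.mul (continuous_apply i).continuousAt).mul (h3.pow _)).mul (h4.pow _)

/-- A row that is strictly beaten at `w` is still beaten nearby, and there are finitely many rows.
-/
theorem eventually_argminRows_subset (w : Fin m → ℝ) :
    ∀ᶠ v in 𝓝 w, argminRows M v ⊆ argminRows M w := by
  have h : ∀ η ∈ M, ∀ᶠ v in 𝓝 w, η ∈ argminRows M v → η ∈ argminRows M w := by
    intro η hη
    by_cases hw : η ∈ argminRows M w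
    · exact Eventually.of_forall fun _ _ => hw
    · have : ∃ η' ∈ M, err η' w < err η w := by
        by_contra! hcon
        exact hw (mem_argminRows.2 ⟨hη, hcon⟩)
      obtain ⟨η', hη', hlt⟩ := this
      filter_upwards [(continuous_err η').continuousAt.eventually_lt
        (continuous_err η).continuousAt hlt] with v hv hmem
      exact absurd ((mem_argminRows.1 hmem).2 η' hη') (not_le.2 hv)
  filter_upwards [(Finset.eventually_all M).2 h] with v hv η hη
  exact hv η (argminRows_subset hη) hη

theorem hypUpdate_eq_of_forall_ne_imp (h : ∀ i, η i ≠ η' i → w i = 0) :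
    hypUpdate η w = hypUpdate η' w := by
  have herr : err η w = err η' w := by
    refine Finset.sum_congr rfl fun i _ => ?_
    by_cases hi : η i = η' i
    · rw [hi]
    · simp [h i hi]
  funext i
  by_cases hi : η i = η' i
  · simp only [hypUpdate, herr, hi]
  · simp [hypUpdate, h i hi]

/-- Where ties are irrelevant, the update is continuous. -/
theorem continuousOn_update (hsel : IsTieBreaking M sel) (hweak : WeakLearnable M)
    {G : Set (Fin m → ℝ)} (hG : G ⊆ stdSimplex ℝ (Fin m))
    (hties : ∀ η ∈ M, ∀ η' ∈ M, sigma M η ∩ sigma M η' ∩ G = ∅ ∨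
      ∀ w ∈ G, ∑ i ∈ Finset.univ.filter (fun i => η i ≠ η' i), w i = 0)
    {c : ℝ} (hc : 0 < c) : ContinuousOn (update M sel) (G ∩ errGe M c) := by
  rintro w ⟨hwG, hw, hwc⟩
  have hM := hweak.nonempty hw
  have h0 := hc.trans_le (hwc _ (bestRow_mem hsel hM w))
  have h1 := hweak.err_bestRow_lt_half hsel hw
  have hcont : ContinuousWithinAt (hypUpdate (bestRow M sel w)) (G ∩ errGe M c) w :=
    (continuousAt_hypUpdate h0.ne' (by linarith)).continuousWithinAt
  refine hcont.congr_of_eventuallyEq ?_ rfl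
  filter_upwards [self_mem_nhdsWithin,
    (eventually_argminRows_subset (M := M) w).filter_mono nhdsWithin_le_nhds] with v hv hsub
  -- The best row at `v` is also a best row at `w`. Since `w ∈ G`, the first alternative of `hties`
  -- fails for these two rows; by the second they differ only on examples of weight zero at `v`,
  -- hence update `v` alike.
  have hmem := hsub (bestRow_mem_argminRows hsel hM v)
  refine hypUpdate_eq_of_forall_ne_imp fun i hi => ?_
  rcases hties _ (bestRow_mem hsel hM v) _ (bestRow_mem hsel hM w) with h | h
  · exact absurd (show w ∈ (∅ : Set _) from
      h ▸ ⟨⟨⟨hw, hmem⟩, ⟨hw, bestRow_mem_argminRows hsel hM w⟩⟩, hwG⟩) (Set.notMem_empty w)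
  · exact (Finset.sum_eq_zero_iff_of_nonneg fun i _ => (hG hv.1).1 i).1 (h v hv.1) i (by simpa)

end Continuity

/-! ### Existence of an invariant measure. -/

section Existence

theorem mapsTo_update_omegaInf (hsel : IsTieBreaking M sel) (hweak : WeakLearnable M) :
    Set.MapsTo (update M sel) (omegaInf M sel) (omegaInf M sel) := by
  intro w hw
  simp only [omegaInf, Set.mem_iInter] at hw ⊢
  intro t ht
  obtain ⟨v, hv, rfl⟩ := hw t ht
  exact ⟨update M sel v, mapsTo_update_sigmaZero hsel hweak hv,
    (Function.iterate_succ_apply _ t v).symm.trans (Function.iterate_succ_apply' _ t v)⟩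

theorem omegaInf_subset_errGe (hsel : IsTieBreaking M sel) (hweak : WeakLearnable M) :
    omegaInf M sel ⊆ errGe M (errorBound m) := by
  intro w hw
  simp only [omegaInf, Set.mem_iInter] at hw
  obtain ⟨v, hv, rfl⟩ := hw (m + 1) (by omega)
  exact mapsTo_iterate_update_errGe hsel hweak hv

theorem exists_isInvariantProb (hsel : IsTieBreaking M sel) (hweak : WeakLearnable M)
    (hties : NoTies M sel) (hne : (omegaInf M sel).Nonempty) :
    ∃ μ : Measure (Fin m → ℝ), IsInvariantProb M sel μ := by
  obtain ⟨G, hG, hGc, hΩG, hties⟩ := hties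
  have hΩ := omegaInf_subset_errGe hsel hweak
  have hc : 0 < errorBound m := errorBound_pos (hΩ hne.some_mem).1
  have hcont := continuousOn_update hsel hweak hG hties hc
  -- `Ω_∞` need not be closed; its closure is used because it remains in the region of continuity,
  -- so invariance extends to it.
  have hsub : closure (omegaInf M sel) ⊆ G ∩ errGe M (errorBound m) :=
    closure_minimal (Set.subset_inter hΩG hΩ) (hGc.isClosed.inter (isClosed_errGe M _))
  have hcont' := hcont.mono hsub
  obtain ⟨μ, hμ, hK, hinv⟩ := exists_measurePreserving_of_mapsTo (measurable_update M sel)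
    (hGc.of_isClosed_subset isClosed_closure (hsub.trans Set.inter_subset_left)) hne.closure
    ((mapsTo_update_omegaInf hsel hweak).closure_of_continuousOn hcont') hcont'
  refine ⟨μ, hμ, ?_, hinv⟩
  filter_upwards [hK] with w hw
  exact ⟨(hsub hw).2.1, fun η hη => hc.trans_le ((hsub hw).2.2 η hη)⟩

end Existence

end AdaBoost

namespace AdaBoost

variable {m : ℕ} {M : Finset (Row m)} {sel : Finset (Row m) → Row m} {η η' : Row m}
  {w : Fin m → ℝ}

/-! ### Almost sure convergence of the coefficients and margins. -/

section Convergence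

/-- The sets `σ*(η)` with `η ∈ M` partition the simplex, so a single term survives. -/
theorem sum_indicator_sigmaStar (hsel : IsTieBreaking M sel) (hM : M.Nonempty)
    (hw : w ∈ stdSimplex ℝ (Fin m)) (a : ℝ) (g : Row m → ℝ) :
    ∑ η ∈ M, a * (sigmaStar M sel η).indicator (fun _ => (1 : ℝ)) w * g η =
      a * g (bestRow M sel w) := by
  rw [Finset.sum_eq_single_of_mem _ (bestRow_mem hsel hM w)]
  · have : w ∈ sigmaStar M sel (bestRow M sel w) := ⟨hw, rfl⟩
    rw [Set.indicator_of_mem this, mul_one]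
  · intro η _ hne
    have : w ∉ sigmaStar M sel η := fun h => hne h.2
    rw [Set.indicator_of_notMem this, mul_zero, zero_mul]

theorem alpha_le (hsel : IsTieBreaking M sel) (hweak : WeakLearnable M) {c : ℝ} (hc : 0 < c)
    (hw : w ∈ errGe M c) : alpha M w ≤ 1 / 2 * Real.log (1 / c) := by
  have hM := hweak.nonempty hw.1
  have h0 := hw.2 _ (bestRow_mem hsel hM w)
  have h1 := hweak.err_bestRow_lt_half hsel hw.1
  rw [alpha, eps_eq_err_bestRow hsel hM]
  refine mul_le_mul_of_nonneg_left (Real.log_le_log ?_ ?_) (by norm_num)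
  · exact div_pos (by linarith) (by linarith)
  · exact div_le_div₀ zero_le_one (by linarith) hc h0

theorem exists_pos_le_alpha (hsel : IsTieBreaking M sel) (hweak : WeakLearnable M) :
    ∃ a : ℝ, 0 < a ∧ ∀ w ∈ sigmaZero M, a ≤ alpha M w := by
  obtain ⟨γ, hγ, h⟩ := id hweak
  refine ⟨1 / 2 * Real.log (1 + 2 * γ), mul_pos (by norm_num) (Real.log_pos (by linarith)), ?_⟩
  intro w hw
  have hM := hweak.nonempty hw.1
  obtain ⟨η, hη, hlt⟩ := h w hw.1
  have h1 := err_bestRow_le hsel hη w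
  have h0 := hw.2 _ (bestRow_mem hsel hM w)
  rw [alpha, eps_eq_err_bestRow hsel hM]
  refine mul_le_mul_of_nonneg_left (Real.log_le_log (by linarith) ?_) (by norm_num)
  -- The constant works because `(2 + 2 * γ) * (1 / 2 - γ) < 1`.
  rw [le_div_iff₀ h0]
  nlinarith

/-- The iterate of order `m + 1` sends `σ₀` into `errGe` and preserves `μ`, so `μ` itself is carried
by `errGe`. -/
theorem IsInvariantProb.ae_forall_weight_mem_errGe {μ : Measure (Fin m → ℝ)}
    (hμ : IsInvariantProb M sel μ) (hsel : IsTieBreaking M sel) (hweak : WeakLearnable M) :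
    ∀ᵐ w ∂μ, ∀ s, weight M sel w s ∈ errGe M (errorBound m) := by
  have hS : MeasurableSet (errGe M (errorBound m)) := (isClosed_errGe M _).measurableSet
  have h : ∀ᵐ w ∂μ, w ∈ errGe M (errorBound m) := by
    have hmp := hμ.invariant.iterate (m + 1)
    rw [← hmp.map_eq]
    refine (ae_map_iff (p := fun w => w ∈ errGe M (errorBound m))
      hmp.measurable.aemeasurable hS).2 ?_
    filter_upwards [hμ.support] with w hw
    exact mapsTo_iterate_update_errGe hsel hweak hw
  exact ae_all_iff.2 fun s => (hμ.invariant.iterate s).quasiMeasurePreserving.ae h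

theorem IsInvariantProb.ae_exists_tendsto_coeffSum_div {μ : Measure (Fin m → ℝ)}
    (hμ : IsInvariantProb M sel μ) (hsel : IsTieBreaking M sel) (hweak : WeakLearnable M)
    (η : Row m) :
    ∀ᵐ w ∂μ, ∃ l, Tendsto (fun T : ℕ => coeffSum M sel w η T / T) atTop (𝓝 l) := by
  have := hμ.prob
  obtain ⟨w₀, hw₀⟩ := hμ.support.exists
  have hM := hweak.nonempty hw₀.1
  have hc : 0 < errorBound m := errorBound_pos hw₀.1
  obtain ⟨a, ha, hle⟩ := exists_pos_le_alpha hsel hweak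
  set S := errGe M (errorBound m)
  have hS : MeasurableSet S := (isClosed_errGe M _).measurableSet
  set f : (Fin m → ℝ) → ℝ := fun w =>
    alpha M w * (sigmaStar M sel η).indicator (fun _ => (1 : ℝ)) w with hf
  -- The ergodic theorem above requires a bound at every point, so `f` is cut off outside `S`;
  -- almost every orbit stays in `S` and does not see the cutoff.
  have hfm : Measurable (S.indicator f) :=
    ((measurable_alpha hsel hM).mul
      (measurable_const.indicator (measurableSet_sigmaStar η))).indicator hS
  have hpos : ∀ w ∈ S, 0 < alpha M w := fun w hw =>
    ha.trans_le (hle w ⟨hw.1, fun η hη => hc.trans_le (hw.2 η hη)⟩)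
  have hB : ∀ w, |S.indicator f w| ≤ |1 / 2 * Real.log (1 / errorBound m)| := by
    intro w
    by_cases hw : w ∈ S
    · rw [Set.indicator_of_mem hw]
      have h1 := alpha_le hsel hweak hc hw
      have h2 := hpos w hw
      by_cases hη : w ∈ sigmaStar M sel η
      · simp only [hf, Set.indicator_of_mem hη, mul_one]
        exact abs_le_abs h1 (by linarith)
      · simp [hf, Set.indicator_of_notMem hη]
    · rw [Set.indicator_of_notMem hw, abs_zero]
      exact abs_nonneg _
  filter_upwards [ae_exists_tendsto_birkhoffAverage hμ.invariant hfm hB,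
    hμ.ae_forall_weight_mem_errGe hsel hweak] with w hw hmem
  obtain ⟨l, hl⟩ := hw
  refine ⟨l, hl.congr fun T => ?_⟩
  rw [birkhoffAverage, smul_eq_mul, inv_mul_eq_div, birkhoffSum, coeffSum]
  congr 1
  exact Finset.sum_congr rfl fun s _ => Set.indicator_of_mem (hmem s) f

/-- Taking `g = 1` gives `alphaSum`; taking `g η = h^η(z)` gives `classifierSum` at `z`. -/
theorem sum_coeffSum_mul (hsel : IsTieBreaking M sel) (hM : M.Nonempty)
    (hw : ∀ s, weight M sel w s ∈ stdSimplex ℝ (Fin m)) (g : Row m → ℝ) (T : ℕ) :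
    ∑ η ∈ M, coeffSum M sel w η T * g η =
      ∑ s ∈ Finset.range T, alpha M (weight M sel w s) * g (bestRow M sel (weight M sel w s)) := by
  simp only [coeffSum, Finset.sum_mul]
  rw [Finset.sum_comm]
  exact Finset.sum_congr rfl fun s _ => sum_indicator_sigmaStar hsel hM (hw s) _ g

theorem exists_distribution_of_tendsto_coeffSum_div {X : Type*} (hsel : IsTieBreaking M sel)
    (hM : M.Nonempty) (hw : ∀ s, weight M sel w s ∈ stdSimplex ℝ (Fin m)) {a : ℝ} (ha : 0 < a)
    (hα : ∀ s, a ≤ alpha M (weight M sel w s))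
    {L : (Fin m → ℝ) → X → ℤˣ} {rep : Row m → X → ℤˣ}
    (hL : ∀ w ∈ stdSimplex ℝ (Fin m), L w = rep (bestRow M sel w))
    (hlim : ∀ η, ∃ l, Tendsto (fun T : ℕ => coeffSum M sel w η T / T) atTop (𝓝 l)) :
    ∃ C : Row m → ℝ, (∀ η ∈ M, 0 ≤ C η) ∧ ∑ η ∈ M, C η = 1 ∧
      (∀ η ∈ M, Tendsto (fun T : ℕ => coeffSum M sel w η T * (alphaSum M sel w T)⁻¹)
        atTop (𝓝 (C η))) ∧
      ∀ z : X, Tendsto (fun T : ℕ => margin M sel L w T z) atTop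
        (𝓝 (∑ η ∈ M, C η * (((rep η z : ℤˣ) : ℤ) : ℝ))) := by
  choose l hl using hlim
  have hsum : ∀ T, ∑ η ∈ M, coeffSum M sel w η T = alphaSum M sel w T := fun T => by
    simpa [alphaSum] using sum_coeffSum_mul hsel hM hw (fun _ => 1) T
  have hαlim : Tendsto (fun T : ℕ => alphaSum M sel w T / T) atTop (𝓝 (∑ η ∈ M, l η)) := by
    simp only [← hsum, Finset.sum_div]
    exact tendsto_finsetSum _ fun η _ => hl η
  have hpos : 0 < ∑ η ∈ M, l η := by
    refine ha.trans_le (ge_of_tendsto hαlim ?_)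
    filter_upwards [eventually_gt_atTop 0] with T hT
    rw [le_div_iff₀ (by exact_mod_cast hT), alphaSum]
    calc a * T = ∑ s ∈ Finset.range T, a := by simp [mul_comm]
      _ ≤ _ := Finset.sum_le_sum fun s _ => hα s
  have hl0 : ∀ η, 0 ≤ l η := fun η => ge_of_tendsto' (hl η) fun T =>
    div_nonneg (Finset.sum_nonneg fun s _ => mul_nonneg (ha.le.trans (hα s))
      (Set.indicator_nonneg (fun _ _ => zero_le_one) _)) (Nat.cast_nonneg _)
  have hC : ∀ η, Tendsto (fun T : ℕ => coeffSum M sel w η T * (alphaSum M sel w T)⁻¹)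
      atTop (𝓝 (l η / ∑ η ∈ M, l η)) := fun η => by
    refine ((hl η).div hαlim hpos.ne').congr' ?_
    filter_upwards [eventually_gt_atTop 0] with T hT
    have : (T : ℝ) ≠ 0 := by exact_mod_cast hT.ne'
    rw [Pi.div_apply, div_div_div_cancel_right₀ this, div_eq_mul_inv]
  refine ⟨fun η => l η / ∑ η ∈ M, l η, fun η _ => div_nonneg (hl0 η) hpos.le, ?_,
    fun η _ => hC η, fun z => ?_⟩
  · rw [← Finset.sum_div, div_self hpos.ne']
  · refine (tendsto_finsetSum M fun η _ =>
      (hC η).mul_const (((rep η z : ℤˣ) : ℤ) : ℝ)).congr fun T => ?_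
    simp only [mul_right_comm, ← Finset.sum_mul]
    rw [sum_coeffSum_mul hsel hM hw (fun η => (((rep η z : ℤˣ) : ℤ) : ℝ)), margin, classifierSum]
    congr 1
    exact Finset.sum_congr rfl fun s _ => by rw [hL _ (hw s)]

theorem IsInvariantProb.ae_exists_distribution {X : Type*} {μ : Measure (Fin m → ℝ)}
    (hμ : IsInvariantProb M sel μ) (hsel : IsTieBreaking M sel) (hweak : WeakLearnable M)
    {L : (Fin m → ℝ) → X → ℤˣ} {rep : Row m → X → ℤˣ}
    (hL : ∀ w ∈ stdSimplex ℝ (Fin m), L w = rep (bestRow M sel w)) :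
    ∀ᵐ w ∂μ, ∃ C : Row m → ℝ, (∀ η ∈ M, 0 ≤ C η) ∧ ∑ η ∈ M, C η = 1 ∧
      (∀ η ∈ M, Tendsto (fun T : ℕ => coeffSum M sel w η T * (alphaSum M sel w T)⁻¹)
        atTop (𝓝 (C η))) ∧
      ∀ z : X, Tendsto (fun T : ℕ => margin M sel L w T z) atTop
        (𝓝 (∑ η ∈ M, C η * (((rep η z : ℤˣ) : ℤ) : ℝ))) := by
  obtain ⟨a, ha, hle⟩ := exists_pos_le_alpha hsel hweak
  filter_upwards [hμ.support,
    -- The exceptional set is a union over rows only, chosen before any point `z`.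
    ae_all_iff.2 fun η => hμ.ae_exists_tendsto_coeffSum_div hsel hweak η] with w hw hlim
  have hmem : ∀ s, weight M sel w s ∈ sigmaZero M := iterate_update_mem_sigmaZero hsel hweak hw
  exact exists_distribution_of_tendsto_coeffSum_div hsel (hweak.nonempty hw.1)
    (fun s => (hmem s).1) ha (fun s => hle _ (hmem s)) hL hlim

end Convergence

end AdaBoost

theorem mainTheorem5 {X : Type*} {m : ℕ}
    (H : Set (X → ℤˣ)) (x : Fin m → X) (y : Fin m → ℤˣ)
    (sel : Finset (AdaBoost.Row m) → AdaBoost.Row m)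
    (hsel : AdaBoost.IsTieBreaking (AdaBoost.errorMatrix H x y) sel)
    (hweak : AdaBoost.WeakLearnable (AdaBoost.errorMatrix H x y))
    (hties : AdaBoost.NoTies (AdaBoost.errorMatrix H x y) sel)
    (hne : (AdaBoost.omegaInf (AdaBoost.errorMatrix H x y) sel).Nonempty)
    (L : (Fin m → ℝ) → X → ℤˣ) (rep : AdaBoost.Row m → X → ℤˣ)
    (hframe : AdaBoost.FollowsFramework H x y sel L rep) :
    (∃ μ : Measure (Fin m → ℝ),
      AdaBoost.IsInvariantProb (AdaBoost.errorMatrix H x y) sel μ) ∧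
    ∀ μ : Measure (Fin m → ℝ),
      AdaBoost.IsInvariantProb (AdaBoost.errorMatrix H x y) sel μ →
      ∀ᵐ w₁ ∂μ, ∃ C : AdaBoost.Row m → ℝ,
        (∀ η ∈ AdaBoost.errorMatrix H x y, 0 ≤ C η) ∧
        ∑ η ∈ AdaBoost.errorMatrix H x y, C η = 1 ∧
        (∀ η ∈ AdaBoost.errorMatrix H x y,
          Tendsto (fun T : ℕ =>
            AdaBoost.coeffSum (AdaBoost.errorMatrix H x y) sel w₁ η T *
              (AdaBoost.alphaSum (AdaBoost.errorMatrix H x y) sel w₁ T)⁻¹)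
            atTop (𝓝 (C η))) ∧
        ∀ z : X,
          Tendsto (fun T : ℕ =>
            AdaBoost.margin (AdaBoost.errorMatrix H x y) sel L w₁ T z)
            atTop (𝓝 (∑ η ∈ AdaBoost.errorMatrix H x y,
              C η * (((rep η z : ℤˣ) : ℤ) : ℝ))) :=
  ⟨AdaBoost.exists_isInvariantProb hsel hweak hties hne, fun _ hμ =>
    hμ.ae_exists_distribution hsel hweak hframe.2⟩
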